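/- **KYP lemma for positive systems.** Let $A\in\mathbb{R}^{n\times n}$ be Metzler (all off-diagonal entries nonnegative) and Hurwitz (all eigenvalues have negative real part), let $B\in\mathbb{R}^{n\times m}$ have nonnegative entries, and let $Q\in\mathbb{R}^{(n+m)\times(n+m)}$ be a symmetric matrix all of whose entries are nonnegative, except possibly its last $m$ diagonal entries. For vectors, $\le,<,\ge,>$ are understood entrywise; for Hermitian matrices, $\preceq 0$ and $\prec 0$ mean negative semidefinite and negative definite (and $\succeq0$, $\succ0$ positive semidefinite and positive definite); $(i\omega I-A)^{-1}B$ is read as its limit $0$ at $\omega=\infty$. If the pair $(-A,B)$ is stabilizable (that is, $-A+BK$ is Hurwitz for some $K\in\mathbb{R}^{m\times n}$), then the following four statements are equivalent: 1. For all $\omega\in[0,\infty]$, $$\begin{bmatrix}(i\omega I-A)^{-1}B\\ I\end{bmatrix}^*Q\begin{bmatrix}(i\omega I-A)^{-1}B\\ I\end{bmatrix}\preceq 0 .$$ 2. $$\begin{bmatrix}-A^{-1}B\\ I\end{bmatrix}^TQ\begin{bmatrix}-A^{-1}B\\ I\end{bmatrix}\preceq 0 .$$ 3. There exists a diagonal $P\in\mathbb{R}^{n\times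 n}$, $P\succeq 0$, such that $$Q+\begin{bmatrix}A^TP+PA&PB\\ B^TP&0\end{bmatrix}\preceq 0 .$$ 4. There exist $x,p\in\mathbb{R}^n$ and $u\in\mathbb{R}^m$ with $x\ge 0$, $p\ge 0$, $u>0$, $$Ax+Bu\le 0\quad\text{and}\quad Q\begin{bmatrix}x\\ u\end{bmatrix}+\begin{bmatrix}A^T\\ B^T\end{bmatrix}p\le 0 .$$ Moreover, without the assumption that $(-A,B)$ is stabilizable, the following four strict versions are equivalent: 1. The matrix in (1) is $\prec 0$ for all $\omega\in[0,\infty]$. 2. The matrix in (2) is $\prec 0$. 3. There exists a diagonal $P\succ 0$ such that the matrix in (3) is $\prec 0$. 4. There exist $x,p\in\mathbb{R}^n$ and $u\in\mathbb{R}^m$ with $x,p,u\ge 0$, $$Ax+Bu<0\quad\text{and}\quad Q\begin{bmatrix}x\\ u\end{bmatrix}+\begin{bmatrix}A^T\\ B^T\end{bmatrix}p<0 .$$ -/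

import Mathlib

open scoped Matrix ENNReal ComplexOrder

namespace PosKYP

/-- A real square matrix is Metzler if its off-diagonal entries are nonnegative. -/
def IsMetzler {n : ℕ} (A : Matrix (Fin n) (Fin n) ℝ) : Prop :=
  ∀ i j, i ≠ j → 0 ≤ A i j

/-- A real square matrix is Hurwitz if all its (complex) eigenvalues have negative real part. -/
def IsHurwitz {n : ℕ} (A : Matrix (Fin n) (Fin n) ℝ) : Prop :=
  ∀ μ : ℂ, Module.End.HasEigenvalue (Matrix.toLin' (A.map ((↑) : ℝ → ℂ))) μ → μ.re < 0

/-- The pair `(A, B)` is stabilizable if some state feedback makes `A + B K` Hurwitz. -/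
def IsStabilizable {n m : ℕ} (A : Matrix (Fin n) (Fin n) ℝ) (B : Matrix (Fin n) (Fin m) ℝ) :
    Prop :=
  ∃ K : Matrix (Fin m) (Fin n) ℝ, IsHurwitz (A + B * K)

/-- `X ⪯ 0`. -/
def NegSemidef {k : Type*} {R : Type*} [Ring R] [PartialOrder R] [StarRing R]
    (X : Matrix k k R) : Prop :=
  (-X).PosSemidef

/-- `X ≺ 0`. -/
def NegDef {k : Type*} {R : Type*} [Ring R] [PartialOrder R] [StarRing R]
    (X : Matrix k k R) : Prop :=
  (-X).PosDef

/-- The matrix `(iωI - A)⁻¹ B` for `ω ∈ [0, ∞]`; at `ω = ∞` it is the limit `0`. -/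
noncomputable def transfer {n m : ℕ} (A : Matrix (Fin n) (Fin n) ℝ)
    (B : Matrix (Fin n) (Fin m) ℝ) (ω : ℝ≥0∞) : Matrix (Fin n) (Fin m) ℂ :=
  if ω = ∞ then 0
  else ((Complex.I * (ω.toReal : ℂ)) • (1 : Matrix (Fin n) (Fin n) ℂ)
      - A.map ((↑) : ℝ → ℂ))⁻¹ * B.map ((↑) : ℝ → ℂ)

/-- The Hermitian matrix `[(iωI - A)⁻¹B; I]^* Q [(iωI - A)⁻¹B; I]`, for `ω ∈ [0, ∞]`. -/
noncomputable def freqForm {n m : ℕ} (A : Matrix (Fin n) (Fin n) ℝ)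
    (B : Matrix (Fin n) (Fin m) ℝ) (Q : Matrix (Fin n ⊕ Fin m) (Fin n ⊕ Fin m) ℝ)
    (ω : ℝ≥0∞) : Matrix (Fin m) (Fin m) ℂ :=
  (Matrix.fromRows (transfer A B ω) (1 : Matrix (Fin m) (Fin m) ℂ))ᴴ
    * Q.map ((↑) : ℝ → ℂ)
    * Matrix.fromRows (transfer A B ω) (1 : Matrix (Fin m) (Fin m) ℂ)

/-- The matrix `[-A⁻¹B; I]^T Q [-A⁻¹B; I]`. -/
noncomputable def staticForm {n m : ℕ} (A : Matrix (Fin n) (Fin n) ℝ)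
    (B : Matrix (Fin n) (Fin m) ℝ) (Q : Matrix (Fin n ⊕ Fin m) (Fin n ⊕ Fin m) ℝ) :
    Matrix (Fin m) (Fin m) ℝ :=
  (Matrix.fromRows (-(A⁻¹ * B)) (1 : Matrix (Fin m) (Fin m) ℝ))ᵀ
    * Q
    * Matrix.fromRows (-(A⁻¹ * B)) (1 : Matrix (Fin m) (Fin m) ℝ)

/-- The matrix `Q + [AᵀP + PA, PB; BᵀP, 0]`. -/
def lmiForm {n m : ℕ} (A : Matrix (Fin n) (Fin n) ℝ)
    (B : Matrix (Fin n) (Fin m) ℝ) (Q : Matrix (Fin n ⊕ Fin m) (Fin n ⊕ Fin m) ℝ)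
    (P : Matrix (Fin n) (Fin n) ℝ) : Matrix (Fin n ⊕ Fin m) (Fin n ⊕ Fin m) ℝ :=
  Q + Matrix.fromBlocks (Aᵀ * P + P * A) (P * B) (Bᵀ * P) 0

/-- The vector `Q [x; u] + [Aᵀ; Bᵀ] p`. -/
def lpVec {n m : ℕ} (A : Matrix (Fin n) (Fin n) ℝ)
    (B : Matrix (Fin n) (Fin m) ℝ) (Q : Matrix (Fin n ⊕ Fin m) (Fin n ⊕ Fin m) ℝ)
    (x p : Fin n → ℝ) (u : Fin m → ℝ) : Fin n ⊕ Fin m → ℝ :=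
  Q *ᵥ Sum.elim x u + Matrix.fromRows Aᵀ Bᵀ *ᵥ p

end PosKYP

/-! Write `S = [-A⁻¹B; I]` and `M = SᵀQS`, the static form. Since `A` is Metzler and Hurwitz, `-A⁻¹
≥ 0`, hence `S ≥ 0`. The possibly negative entries of `Q` affect only the diagonal of `M`, so `M` is
a symmetric Metzler matrix. Everything passes through `M`.

Frequency side: at `ω = 0` the frequency form is `M`. Conversely, `|(iωI - A)⁻¹Bv| ≤ -A⁻¹B|v|`
entrywise, so the form at any `ω` and `v` is at most that of `M` at `|v|`.

Linear and matrix inequalities: definiteness of a symmetric Metzler matrix is tested on one positive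
vector. If `M` is negative (semi)definite, a Perron–Frobenius argument gives `u > 0` with `Mu < 0`
(resp. `≤ 0`). The response `x` to `u` and the `p` that cancels the state rows then solve (4), up to
a small slack in the strict case. Given (4) with `x > 0`, the choice `P = diag(pᵢ/xᵢ)` makes the
matrix in (3) a symmetric Metzler matrix sending `[x; u] > 0` to a nonpositive vector, which forces
semidefiniteness; the strict case is analogous. Finally (3) gives (2) by congruence with `S`,
because `[A B]S = 0` removes `P`.

Stabilizability serves only to make `x > 0` in the nonstrict case; strict inequalities make `x`,
`p`, `u` positive by themselves. -/

namespace PosKYP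

/-! ### Metzler matrices and their quadratic forms -/

section Metzler

variable {ι : Type*} [Fintype ι]

/-- A Metzler matrix maps a nonnegative vector to a vector that is nonnegative wherever the
original vector vanishes. -/
lemma mulVec_nonneg_of_apply_eq_zero {A : Matrix ι ι ℝ} (hA : ∀ i j, i ≠ j → 0 ≤ A i j)
    {x : ι → ℝ} (hx : ∀ i, 0 ≤ x i) {i : ι} (hi : x i = 0) : 0 ≤ (A *ᵥ x) i := by
  refine Finset.sum_nonneg fun j _ => ?_
  by_cases h : i = j
  · subst h; simp [hi]
  · exact mul_nonneg (hA i j h) (hx j)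

/-- If `A v < 0` for some `v > 0`, then `A x ≤ 0` implies `x ≥ 0` for Metzler `A`. -/
lemma nonneg_of_mulVec_nonpos {A : Matrix ι ι ℝ} (hA : ∀ i j, i ≠ j → 0 ≤ A i j)
    {v : ι → ℝ} (hv : ∀ i, 0 < v i) (hAv : ∀ i, (A *ᵥ v) i < 0)
    {x : ι → ℝ} (hx : ∀ i, (A *ᵥ x) i ≤ 0) (i : ι) : 0 ≤ x i := by
  obtain ⟨k, -, hk⟩ := Finset.exists_min_image Finset.univ (fun i => x i / v i) ⟨i, by simp⟩
  have hk' : 0 ≤ x k / v k := by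
    by_contra! hneg
    -- By minimality of the ratio at `k`, the vector `x - (x k / v k) • v` is nonnegative and
    -- vanishes at `k`; a negative ratio would make its image negative there.
    have h1 : 0 ≤ (A *ᵥ (x - (x k / v k) • v)) k := by
      refine mulVec_nonneg_of_apply_eq_zero hA (fun j => ?_) ?_
      · have := (le_div_iff₀ (hv j)).1 (hk j (by simp))
        simpa using this
      · have := (hv k).ne'
        simp [this]
    rw [Matrix.mulVec_sub, Matrix.mulVec_smul] at h1
    have h2 := mul_pos_of_neg_of_neg hneg (hAv k)
    have h3 := hx k
    simp only [Pi.sub_apply, Pi.smul_apply, smul_eq_mul] at h1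
    linarith
  have h := (le_div_iff₀ (hv i)).1 (hk'.trans (hk i (by simp)))
  simpa using h

/-- The quadratic form of a symmetric Metzler matrix is bounded by a diagonal form. -/
lemma dotProduct_mulVec_le_of_pos {M : Matrix ι ι ℝ} (hM : M.IsSymm)
    (hM0 : ∀ i j, i ≠ j → 0 ≤ M i j) {u : ι → ℝ} (hu : ∀ i, 0 < u i) (v : ι → ℝ) :
    v ⬝ᵥ M *ᵥ v ≤ ∑ i, (M *ᵥ u) i * (v i ^ 2 / u i) := by
  have h1 : ∑ i, (M *ᵥ u) i * (v i ^ 2 / u i) = ∑ i, ∑ j, M i j * (u j / u i * v i ^ 2) := by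
    refine Finset.sum_congr rfl fun i _ => ?_
    simp only [Matrix.mulVec, dotProduct, Finset.sum_mul]
    exact Finset.sum_congr rfl fun j _ => by ring
  have h2 : ∑ i, (M *ᵥ u) i * (v i ^ 2 / u i) = ∑ i, ∑ j, M i j * (u i / u j * v j ^ 2) := by
    rw [h1, Finset.sum_comm]
    exact Finset.sum_congr rfl fun i _ => Finset.sum_congr rfl fun j _ => by rw [hM.apply]
  have h3 : v ⬝ᵥ M *ᵥ v = ∑ i, ∑ j, M i j * (v i * v j) := by
    simp only [Matrix.mulVec, dotProduct, Finset.mul_sum]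
    exact Finset.sum_congr rfl fun i _ => Finset.sum_congr rfl fun j _ => by ring
  have h4 : 0 ≤ ∑ i, ∑ j, (M i j * (u j / u i * v i ^ 2) + M i j * (u i / u j * v j ^ 2)
      - 2 * (M i j * (v i * v j))) := by
    refine Finset.sum_nonneg fun i _ => Finset.sum_nonneg fun j _ => ?_
    have hi := (hu i).ne'
    have hj := (hu j).ne'
    -- Twice the gap is a sum of weighted squares. The square vanishes for `i = j`, so the signs of
    -- the diagonal entries do not matter.
    have key : M i j * (u j / u i * v i ^ 2) + M i j * (u i / u j * v j ^ 2)
        - 2 * (M i j * (v i * v j)) = M i j * ((u j * v i - u i * v j) ^ 2 / (u i * u j)) := by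
      field_simp
      ring
    rw [key]
    by_cases h : i = j
    · subst h; simp
    · exact mul_nonneg (hM0 i j h)
        (div_nonneg (sq_nonneg _) (mul_pos (hu i) (hu j)).le)
  simp only [Finset.sum_sub_distrib, Finset.sum_add_distrib, ← Finset.mul_sum] at h4
  rw [← h1, ← h2, ← h3] at h4
  linarith

lemma negSemidef_iff {M : Matrix ι ι ℝ} (hM : M.IsSymm) :
    NegSemidef M ↔ ∀ v, v ⬝ᵥ M *ᵥ v ≤ 0 := by
  simp [NegSemidef, Matrix.posSemidef_iff_dotProduct_mulVec, hM,
    Matrix.neg_mulVec]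

lemma negDef_iff {M : Matrix ι ι ℝ} (hM : M.IsSymm) :
    NegDef M ↔ ∀ v, v ≠ 0 → v ⬝ᵥ M *ᵥ v < 0 := by
  simp [NegDef, Matrix.posDef_iff_dotProduct_mulVec, hM,
    Matrix.neg_mulVec]

lemma negSemidef_of_mulVec_nonpos {M : Matrix ι ι ℝ} (hM : M.IsSymm)
    (hM0 : ∀ i j, i ≠ j → 0 ≤ M i j) {u : ι → ℝ} (hu : ∀ i, 0 < u i)
    (hMu : ∀ i, (M *ᵥ u) i ≤ 0) : NegSemidef M :=
  (negSemidef_iff hM).2 fun v => (dotProduct_mulVec_le_of_pos hM hM0 hu v).trans <|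
    Finset.sum_nonpos fun i _ =>
      mul_nonpos_of_nonpos_of_nonneg (hMu i) (div_nonneg (sq_nonneg _) (hu i).le)

lemma negDef_of_mulVec_neg {M : Matrix ι ι ℝ} (hM : M.IsSymm)
    (hM0 : ∀ i j, i ≠ j → 0 ≤ M i j) {u : ι → ℝ} (hu : ∀ i, 0 < u i)
    (hMu : ∀ i, (M *ᵥ u) i < 0) : NegDef M := by
  refine (negDef_iff hM).2 fun v hv => (dotProduct_mulVec_le_of_pos hM hM0 hu v).trans_lt ?_
  obtain ⟨k, hk⟩ := Function.ne_iff.1 hv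
  refine Finset.sum_neg' (fun i _ => mul_nonpos_of_nonpos_of_nonneg (hMu i).le
    (div_nonneg (sq_nonneg _) (hu i).le)) ⟨k, Finset.mem_univ k, ?_⟩
  have : v k ≠ 0 := hk
  exact mul_neg_of_neg_of_pos (hMu k) (div_pos (by positivity) (hu k))

lemma dotProduct_mulVec_le_abs {M : Matrix ι ι ℝ} (hM0 : ∀ i j, i ≠ j → 0 ≤ M i j) (v : ι → ℝ) :
    v ⬝ᵥ M *ᵥ v ≤ |v| ⬝ᵥ M *ᵥ |v| := by
  simp only [Matrix.mulVec, dotProduct, Finset.mul_sum, Pi.abs_apply]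
  refine Finset.sum_le_sum fun i _ => Finset.sum_le_sum fun j _ => ?_
  by_cases h : i = j
  · subst h
    exact le_of_eq (by linear_combination (-M i i) * abs_mul_abs_self (v i))
  · calc v i * (M i j * v j) = M i j * (v i * v j) := by ring
      _ ≤ M i j * |v i * v j| := mul_le_mul_of_nonneg_left (le_abs_self _) (hM0 i j h)
      _ = |v i| * (M i j * |v j|) := by rw [abs_mul]; ring

lemma mulVec_eq_zero_of_negSemidef {M : Matrix ι ι ℝ} (hneg : NegSemidef M) {v : ι → ℝ}
    (hv : 0 ≤ v ⬝ᵥ M *ᵥ v) : M *ᵥ v = 0 := by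
  have h1 := Matrix.PosSemidef.dotProduct_mulVec_nonneg hneg v
  have h2 := (Matrix.PosSemidef.dotProduct_mulVec_zero_iff hneg v).1
  simp only [Matrix.neg_mulVec, star_trivial, dotProduct_neg, neg_eq_zero] at h1 h2
  exact h2 (by linarith)

variable [DecidableEq ι]

/-- A Metzler matrix without eigenvalues in `[0, ∞)` maps some positive vector to the vector with
all entries `-1`. -/
lemma exists_pos_mulVec_eq_neg_one {A : Matrix ι ι ℝ} (hA : ∀ i j, i ≠ j → 0 ≤ A i j)
    (hdet : ∀ t : ℝ, 0 ≤ t → (t • (1 : Matrix ι ι ℝ) - A).det ≠ 0) :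
    ∃ v : ι → ℝ, (∀ i, 0 < v i) ∧ A *ᵥ v = fun _ => -1 := by
  -- Continuity in `t`: the solution `f t` of `(tI - A) f = 1` is positive for large `t`, and
  -- positivity is both an open and a closed condition on `[0, ∞)`, so it persists down to `t = 0`.
  let N : Set.Ici (0 : ℝ) → Matrix ι ι ℝ := fun t => (t : ℝ) • (1 : Matrix ι ι ℝ) - A
  have hN : Continuous N := by fun_prop
  have hd : ∀ t, (N t).det ≠ 0 := fun t => hdet t t.2
  let f : Set.Ici (0 : ℝ) → ι → ℝ := fun t => ((N t).det)⁻¹ • ((N t).adjugate *ᵥ fun _ => 1)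
  have hf : Continuous f :=
    (hN.matrix_det.inv₀ hd).smul (hN.matrix_adjugate.matrix_mulVec continuous_const)
  have hfN : ∀ t, N t *ᵥ f t = fun _ => 1 := fun t => by
    simp only [f, Matrix.mulVec_smul, Matrix.mulVec_mulVec, Matrix.mul_adjugate,
      Matrix.smul_mulVec, Matrix.one_mulVec, smul_smul, inv_mul_cancel₀ (hd t), one_smul]
  have hfA : ∀ (t : Set.Ici (0 : ℝ)) i, (t : ℝ) * f t i - (A *ᵥ f t) i = 1 := fun t i => by
    have := congrFun (hfN t) i
    simpa [N, Matrix.sub_mulVec, Matrix.smul_mulVec] using this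
  -- A nonnegative solution cannot vanish at `i`: the equation would read `-(A f)ᵢ = 1` with `(A f)ᵢ
  -- ≥ 0`.
  have hset : {t | ∀ i, 0 < f t i} = {t | ∀ i, 0 ≤ f t i} := by
    ext t
    refine ⟨fun h i => (h i).le, fun h i => (h i).lt_of_ne fun h0 => ?_⟩
    have h1 := mulVec_nonneg_of_apply_eq_zero hA h h0.symm
    have h2 := hfA t i
    rw [← h0] at h2
    linarith
  have hclopen : IsClopen {t | ∀ i, 0 < f t i} := by
    constructor
    · rw [hset, Set.ofPred_forall]
      exact isClosed_iInter fun i =>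
        isClosed_le continuous_const ((continuous_apply i).comp hf)
    · rw [Set.ofPred_forall]
      exact isOpen_iInter_of_finite fun i =>
        isOpen_lt continuous_const ((continuous_apply i).comp hf)
  have : PreconnectedSpace (Set.Ici (0 : ℝ)) :=
    isPreconnected_iff_preconnectedSpace.1 isPreconnected_Ici
  have huniv : {t | ∀ i, 0 < f t i} = Set.univ := by
    refine (isClopen_iff.1 hclopen).resolve_left (Set.nonempty_iff_ne_empty.1 ?_)
    have hs : ∀ i, ∑ j, A i j ≤ ∑ i, |∑ j, A i j| := fun i =>
      (le_abs_self _).trans (Finset.single_le_sum (f := fun i => |∑ j, A i j|)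
        (fun _ _ => abs_nonneg _) (Finset.mem_univ i))
    have hT : 0 ≤ ∑ i, |∑ j, A i j| := Finset.sum_nonneg fun _ _ => abs_nonneg _
    -- This `t` exceeds every row sum of `A`. At a minimal entry `k` of `f t`, comparison with a
    -- constant vector gives `(t - ∑ⱼ A k j) * f t k ≥ 1`.
    refine ⟨⟨(∑ i, |∑ j, A i j|) + 1, by simp only [Set.mem_Ici]; linarith⟩, fun i => ?_⟩
    set t : Set.Ici (0 : ℝ) := ⟨(∑ i, |∑ j, A i j|) + 1, _⟩ with ht
    obtain ⟨k, -, hk⟩ := Finset.exists_min_image Finset.univ (f t) ⟨i, by simp⟩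
    refine lt_of_lt_of_le ?_ (hk i (by simp))
    have h1 : 0 ≤ (A *ᵥ (f t - fun _ => f t k)) k :=
      mulVec_nonneg_of_apply_eq_zero hA (fun j => by simpa using hk j (by simp)) (by simp)
    have h2 : (A *ᵥ fun _ => f t k) k = (∑ j, A k j) * f t k := by
      simp [Matrix.mulVec, dotProduct, Finset.sum_mul]
    rw [Matrix.mulVec_sub, Pi.sub_apply, h2] at h1
    have h3 := hfA t k
    have h4 := hs k
    have h5 : (t : ℝ) = (∑ i, |∑ j, A i j|) + 1 := rfl
    by_contra! hneg
    have : ((t : ℝ) - ∑ j, A k j) * f t k ≤ 0 :=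
      mul_nonpos_of_nonneg_of_nonpos (by linarith) hneg
    linarith
  have h0 : (⟨0, Set.self_mem_Ici⟩ : Set.Ici (0 : ℝ)) ∈ {t | ∀ i, 0 < f t i} :=
    huniv ▸ Set.mem_univ _
  refine ⟨f ⟨0, Set.self_mem_Ici⟩, h0, funext fun i => ?_⟩
  have := hfA ⟨0, Set.self_mem_Ici⟩ i
  simp only [zero_mul] at this
  linarith

/-- A symmetric negative definite Metzler matrix maps a positive vector to a negative one. -/
lemma exists_pos_mulVec_eq_neg_one_of_negDef {M : Matrix ι ι ℝ} (hM : M.IsSymm)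
    (hM0 : ∀ i j, i ≠ j → 0 ≤ M i j) (hneg : NegDef M) :
    ∃ u : ι → ℝ, (∀ i, 0 < u i) ∧ M *ᵥ u = fun _ => -1 := by
  refine exists_pos_mulVec_eq_neg_one hM0 fun t ht hdet => ?_
  obtain ⟨v, hv, hv0⟩ := Matrix.exists_mulVec_eq_zero_iff.2 hdet
  rw [Matrix.sub_mulVec, Matrix.smul_mulVec, Matrix.one_mulVec, sub_eq_zero] at hv0
  have h := (negDef_iff hM).1 hneg v hv
  rw [← hv0, dotProduct_smul, smul_eq_mul] at h
  have h1 : 0 ≤ v ⬝ᵥ v := by simpa using dotProduct_star_self_nonneg v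
  exact absurd h (not_lt.2 (mul_nonneg ht h1))

/-- A symmetric negative semidefinite Metzler matrix maps a positive vector to a nonpositive
one. -/
lemma exists_pos_mulVec_nonpos_of_negSemidef {M : Matrix ι ι ℝ} (hM : M.IsSymm)
    (hM0 : ∀ i j, i ≠ j → 0 ≤ M i j) (hneg : NegSemidef M) :
    ∃ u : ι → ℝ, (∀ i, 0 < u i) ∧ ∀ i, (M *ᵥ u) i ≤ 0 := by
  -- Passing to `|v|` does not decrease the form, and `0` is its maximum, so the kernel is closed
  -- under absolute values.
  have habs : ∀ v, M *ᵥ v = 0 → M *ᵥ |v| = 0 := fun v hv => by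
    refine mulVec_eq_zero_of_negSemidef hneg ?_
    simpa [hv] using dotProduct_mulVec_le_abs hM0 v
  have hex : ∀ i, ∃ v : ι → ℝ, (∀ j, 0 ≤ v j) ∧ M *ᵥ v = 0 ∧
      (v i = 0 → ∀ w, M *ᵥ w = 0 → w i = 0) := fun i => by
    by_cases h : ∃ w, M *ᵥ w = 0 ∧ w i ≠ 0
    · obtain ⟨w, hw, hwi⟩ := h
      exact ⟨|w|, fun j => abs_nonneg _, habs w hw, fun h => absurd (abs_eq_zero.1 h) hwi⟩
    · push Not at h
      exact ⟨0, fun _ => le_rfl, by simp, fun _ => h⟩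
  choose f hf0 hfM hfi using hex
  -- A nonnegative kernel vector of maximal support: summing nonnegative vectors causes no
  -- cancellation.
  obtain ⟨k, hk0, hkM, hki⟩ : ∃ k : ι → ℝ, (∀ j, 0 ≤ k j) ∧ M *ᵥ k = 0 ∧
      ∀ i, k i = 0 → ∀ w, M *ᵥ w = 0 → w i = 0 := by
    refine ⟨∑ i, f i, fun j => ?_, ?_, fun i hi => ?_⟩
    · rw [Finset.sum_apply]; exact Finset.sum_nonneg fun i _ => hf0 i j
    · rw [Matrix.mulVec_sum]; exact Finset.sum_eq_zero fun i _ => hfM i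
    · rw [Finset.sum_apply] at hi
      exact hfi i ((Finset.sum_eq_zero_iff_of_nonneg fun l _ => hf0 l i).1 hi i (by simp))
  -- Off the support of `k`, each row of `M k = 0` is a vanishing sum of nonnegative terms. With
  -- symmetry, `M` splits into two diagonal blocks.
  have hblock : ∀ i j, k i = 0 → k j ≠ 0 → M i j = 0 := fun i j hi hj => by
    have h1 : ∑ l, M i l * k l = 0 := congrFun hkM i
    have h2 := (Finset.sum_eq_zero_iff_of_nonneg fun l _ => by
      by_cases h : i = l
      · rw [← h, hi, mul_zero]
      · exact mul_nonneg (hM0 i l h) (hk0 l)).1 h1 j (by simp)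
    exact (mul_eq_zero.1 h2).resolve_right hj
  -- Subtracting 1 on the diagonal over the support of `k` destroys the kernel. The definite case
  -- then yields `w`, to be used off the support and glued to `k` on it.
  let D : Matrix ι ι ℝ := Matrix.diagonal fun i => if k i = 0 then 0 else 1
  have hD : ∀ v i, (D *ᵥ v) i = if k i = 0 then 0 else v i := fun v i => by
    simp only [D, Matrix.mulVec_diagonal]; split_ifs <;> simp
  have hdef : NegDef (M - D) := by
    refine (negDef_iff (hM.sub (Matrix.isSymm_diagonal _))).2 fun v hv => ?_
    have h1 := (negSemidef_iff hM).1 hneg v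
    have h2 : ∀ i, 0 ≤ v i * (D *ᵥ v) i := fun i => by
      rw [hD]; split_ifs
      · simp
      · exact mul_self_nonneg _
    have h3 : 0 ≤ v ⬝ᵥ D *ᵥ v := Finset.sum_nonneg fun i _ => h2 i
    rw [Matrix.sub_mulVec, dotProduct_sub]
    refine lt_of_le_of_ne (by linarith) fun h => hv ?_
    have h4 := mulVec_eq_zero_of_negSemidef hneg (v := v) (by linarith)
    have h5 : v ⬝ᵥ D *ᵥ v = 0 := by linarith
    ext i
    by_cases hi : k i = 0
    · exact hki i hi v h4
    · have := (Finset.sum_eq_zero_iff_of_nonneg fun i _ => h2 i).1 h5 i (by simp)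
      rw [hD, if_neg hi] at this
      exact mul_self_eq_zero.1 this
  obtain ⟨w, hw, hMw⟩ := exists_pos_mulVec_eq_neg_one_of_negDef
    (hM.sub (Matrix.isSymm_diagonal _)) (fun i j hij => by
      simpa [D, Matrix.diagonal_apply_ne _ hij] using hM0 i j hij) hdef
  refine ⟨fun i => if k i = 0 then w i else k i, fun i => ?_, fun i => ?_⟩
  · dsimp only
    split_ifs with h
    · exact hw i
    · exact (hk0 i).lt_of_ne' h
  · by_cases hi : k i = 0
    · have h1 := congrFun hMw i
      rw [Matrix.sub_mulVec, Pi.sub_apply, hD, if_pos hi, sub_zero] at h1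
      have h2 : (M *ᵥ fun i => if k i = 0 then w i else k i) i = (M *ᵥ w) i := by
        refine Finset.sum_congr rfl fun j _ => ?_
        by_cases hj : k j = 0
        · simp [hj]
        · simp [hblock i j hi hj]
      rw [h2, h1]; norm_num
    · have h2 : (M *ᵥ fun i => if k i = 0 then w i else k i) i = (M *ᵥ k) i := by
        refine Finset.sum_congr rfl fun j _ => ?_
        by_cases hj : k j = 0
        · simp [← hM.apply i j, hblock j i hj hi]
        · simp [hj]
      rw [h2, hkM]; rfl

end Metzler

end PosKYP

namespace PosKYP

/-! ### Hurwitz matrices and stabilizability -/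

section Hurwitz

variable {n m : ℕ} {A : Matrix (Fin n) (Fin n) ℝ}

lemma IsHurwitz.det_ne_zero (hAH : IsHurwitz A) {μ : ℂ} (hμ : 0 ≤ μ.re) :
    (μ • (1 : Matrix (Fin n) (Fin n) ℂ) - A.map ((↑) : ℝ → ℂ)).det ≠ 0 := fun h => by
  obtain ⟨v, hv, hv0⟩ := Matrix.exists_mulVec_eq_zero_iff.2 h
  refine not_lt.2 hμ (hAH μ ?_)
  refine Module.End.hasEigenvalue_of_hasEigenvector (x := v)
    (Module.End.hasEigenvector_iff.2 ⟨Module.End.mem_eigenspace_iff.2 ?_, hv⟩)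
  rw [Matrix.sub_mulVec, Matrix.smul_mulVec, Matrix.one_mulVec, sub_eq_zero] at hv0
  rw [Matrix.toLin'_apply, hv0]

lemma IsHurwitz.re_neg_of_vecMul_eq (hAH : IsHurwitz A) {μ : ℂ} {y : Fin n → ℂ} (hy : y ≠ 0)
    (h : y ᵥ* A.map ((↑) : ℝ → ℂ) = μ • y) : μ.re < 0 := by
  by_contra! hμ
  refine hAH.det_ne_zero hμ (Matrix.exists_vecMul_eq_zero_iff.1 ⟨y, hy, ?_⟩)
  rw [Matrix.vecMul_sub, h, Matrix.vecMul_smul, Matrix.vecMul_one, sub_self]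

lemma map_ofReal_smul_one_sub (t : ℝ) : ((t : ℂ) • (1 : Matrix (Fin n) (Fin n) ℂ)
    - A.map ((↑) : ℝ → ℂ)) = (t • (1 : Matrix (Fin n) (Fin n) ℝ) - A).map ((↑) : ℝ → ℂ) := by
  ext i j
  by_cases h : i = j <;> simp [h]

lemma IsHurwitz.det_smul_one_sub_ne_zero (hAH : IsHurwitz A) {t : ℝ} (ht : 0 ≤ t) :
    (t • (1 : Matrix (Fin n) (Fin n) ℝ) - A).det ≠ 0 := fun h => by
  refine hAH.det_ne_zero (μ := t) (by simpa using ht) ?_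
  rw [map_ofReal_smul_one_sub]
  have := RingHom.map_det Complex.ofRealHom (t • (1 : Matrix (Fin n) (Fin n) ℝ) - A)
  rw [h, map_zero] at this
  exact this.symm

lemma IsHurwitz.isUnit_det (hAH : IsHurwitz A) : IsUnit A.det := by
  have h := hAH.det_smul_one_sub_ne_zero le_rfl
  rw [zero_smul, zero_sub, Matrix.det_neg] at h
  exact isUnit_iff_ne_zero.2 (right_ne_zero_of_mul h)

lemma IsMetzler.exists_pos (hA : IsMetzler A) (hAH : IsHurwitz A) :
    ∃ v : Fin n → ℝ, (∀ i, 0 < v i) ∧ A *ᵥ v = fun _ => -1 :=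
  exists_pos_mulVec_eq_neg_one hA fun _ ht => hAH.det_smul_one_sub_ne_zero ht

lemma IsMetzler.nonneg_of_mulVec_nonpos (hA : IsMetzler A) (hAH : IsHurwitz A) {x : Fin n → ℝ}
    (hx : ∀ i, (A *ᵥ x) i ≤ 0) (i : Fin n) : 0 ≤ x i := by
  obtain ⟨v, hv, hAv⟩ := hA.exists_pos hAH
  exact PosKYP.nonneg_of_mulVec_nonpos hA hv (fun i => by simp [hAv]) hx i

/-- Column `j` of `-A⁻¹` is sent by `A` to `-eⱼ ≤ 0`, hence is nonnegative. -/
lemma IsMetzler.inv_nonpos (hA : IsMetzler A) (hAH : IsHurwitz A) (i j : Fin n) :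
    A⁻¹ i j ≤ 0 := by
  have h := hA.nonneg_of_mulVec_nonpos hAH (x := -(A⁻¹ *ᵥ Pi.single j 1)) (fun i => by
    rw [Matrix.mulVec_neg, Matrix.mulVec_mulVec, Matrix.mul_nonsing_inv _ hAH.isUnit_det,
      Matrix.one_mulVec, Pi.neg_apply, neg_nonpos]
    by_cases hij : i = j
    · subst hij; simp
    · simp [hij]) i
  simpa using h

/-- If `A x + B u ≤ 0` with `x ≥ 0`, `u > 0`, then `x > 0` as soon as `(-A, B)` is
stabilizable. -/
lemma IsStabilizable.pos_of_mulVec_nonpos {B : Matrix (Fin n) (Fin m) ℝ}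
    (hst : IsStabilizable (-A) B) (hA : IsMetzler A) (hAH : IsHurwitz A)
    (hB : ∀ i j, 0 ≤ B i j) {x : Fin n → ℝ} {u : Fin m → ℝ} (hx : ∀ i, 0 ≤ x i)
    (hu : ∀ j, 0 < u j) (h : ∀ i, (A *ᵥ x + B *ᵥ u) i ≤ 0) (i : Fin n) : 0 < x i := by
  refine (hx i).lt_of_ne fun hi => ?_
  obtain ⟨K, hK⟩ := hst
  have hzero : ∀ k, x k = 0 → (A *ᵥ x) k = 0 ∧ (B *ᵥ u) k = 0 := fun k hk => by
    have h1 := mulVec_nonneg_of_apply_eq_zero hA hx hk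
    have h2 : 0 ≤ ∑ j, B k j * u j :=
      Finset.sum_nonneg fun j _ => mul_nonneg (hB k j) (hu j).le
    change 0 ≤ (B *ᵥ u) k at h2
    have h3 := h k
    rw [Pi.add_apply] at h3
    exact ⟨by linarith, by linarith⟩
  have hAz : ∀ k l, x k = 0 → x l ≠ 0 → A k l = 0 := fun k l hk hl => by
    have h1 : ∑ j, A k j * x j = 0 := (hzero k hk).1
    have := (Finset.sum_eq_zero_iff_of_nonneg fun j _ => by
      by_cases hkj : k = j
      · rw [← hkj, hk, mul_zero]
      · exact mul_nonneg (hA k j hkj) (hx j)).1 h1 l (by simp)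
    exact (mul_eq_zero.1 this).resolve_right hl
  have hBz : ∀ k l, x k = 0 → B k l = 0 := fun k l hk => by
    have h1 : ∑ j, B k j * u j = 0 := (hzero k hk).2
    have := (Finset.sum_eq_zero_iff_of_nonneg fun j _ =>
      mul_nonneg (hB k j) (hu j).le).1 h1 l (by simp)
    exact (mul_eq_zero.1 this).resolve_right (hu l).ne'
  -- Hautus test: the vectors supported on the zero set of `x` are `Aᵀ`-invariant and killed by
  -- `Bᵀ`. A left eigenvector of `A` among them, with eigenvalue `μ`, is one of `-A + BK` with
  -- eigenvalue `-μ`, yet both real parts must be negative.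
  let W : Submodule ℂ (Fin n → ℂ) :=
    { carrier := {y | ∀ k, x k ≠ 0 → y k = 0}
      add_mem' := fun ha hb k hk => by simp [ha k hk, hb k hk]
      zero_mem' := fun k _ => rfl
      smul_mem' := fun c y hy k hk => by simp [hy k hk] }
  have hW : ∀ y ∈ W, Matrix.toLin' (A.map ((↑) : ℝ → ℂ))ᵀ y ∈ W := fun y hy k hk => by
    simp only [Matrix.toLin'_apply, Matrix.mulVec, dotProduct]
    refine Finset.sum_eq_zero fun l _ => ?_
    by_cases hl : x l = 0
    · simp [hAz l k hl hk]
    · simp [hy l hl]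
  have hne : Nontrivial W := by
    refine ⟨⟨⟨Pi.single i 1, fun k hk => ?_⟩, 0, fun h0 => ?_⟩⟩
    · exact Pi.single_eq_of_ne (by rintro rfl; exact hk hi.symm) _
    · simpa using congrFun (congrArg Subtype.val h0) i
  obtain ⟨μ, hμ⟩ := Module.End.exists_eigenvalue
    ((Matrix.toLin' (A.map ((↑) : ℝ → ℂ))ᵀ).restrict hW)
  obtain ⟨⟨y, hyW⟩, hy⟩ := hμ.exists_hasEigenvector
  have hy0 : y ≠ 0 := fun h0 => hy.2 (Subtype.ext h0)
  have hyA : y ᵥ* A.map ((↑) : ℝ → ℂ) = μ • y := by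
    have := congrArg Subtype.val hy.apply_eq_smul
    rwa [LinearMap.coe_restrict_apply, Matrix.toLin'_apply, Matrix.mulVec_transpose] at this
  have hyB : y ᵥ* B.map ((↑) : ℝ → ℂ) = 0 := by
    ext j
    simp only [Matrix.vecMul, dotProduct, Pi.zero_apply]
    refine Finset.sum_eq_zero fun l _ => ?_
    by_cases hl : x l = 0
    · simp [hBz l j hl]
    · simp [hyW l hl]
  have hmap : (-A + B * K).map ((↑) : ℝ → ℂ)
      = -A.map ((↑) : ℝ → ℂ) + B.map ((↑) : ℝ → ℂ) * K.map ((↑) : ℝ → ℂ) := by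
    ext i j; simp [Matrix.mul_apply]
  have h1 := hAH.re_neg_of_vecMul_eq hy0 hyA
  have h2 := hK.re_neg_of_vecMul_eq (μ := -μ) hy0 (by
    rw [hmap, Matrix.vecMul_add, Matrix.vecMul_neg, hyA, ← Matrix.vecMul_vecMul, hyB]
    simp)
  rw [Complex.neg_re] at h2
  linarith

end Hurwitz

/-! ### Algebra of the static gain and of the matrix inequality -/

section Static

variable {n m : ℕ} {A : Matrix (Fin n) (Fin n) ℝ} {B : Matrix (Fin n) (Fin m) ℝ}
  {Q : Matrix (Fin n ⊕ Fin m) (Fin n ⊕ Fin m) ℝ}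

/-- The matrix `[-A⁻¹B; I]`. -/
noncomputable def staticMap (A : Matrix (Fin n) (Fin n) ℝ) (B : Matrix (Fin n) (Fin m) ℝ) :
    Matrix (Fin n ⊕ Fin m) (Fin m) ℝ :=
  Matrix.fromRows (-(A⁻¹ * B)) 1

lemma staticMap_mulVec (u : Fin m → ℝ) :
    staticMap A B *ᵥ u = Sum.elim (-(A⁻¹ * B) *ᵥ u) u := by
  rw [staticMap, Matrix.fromRows_mulVec, Matrix.one_mulVec]

lemma staticForm_mulVec (u : Fin m → ℝ) :
    staticForm A B Q *ᵥ u = (staticMap A B)ᵀ *ᵥ (Q *ᵥ (staticMap A B *ᵥ u)) := by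
  rw [Matrix.mulVec_mulVec, Matrix.mulVec_mulVec]; rfl

lemma dotProduct_staticForm_mulVec (u : Fin m → ℝ) :
    u ⬝ᵥ staticForm A B Q *ᵥ u = (staticMap A B *ᵥ u) ⬝ᵥ Q *ᵥ (staticMap A B *ᵥ u) := by
  rw [staticForm_mulVec, Matrix.dotProduct_mulVec, Matrix.vecMul_transpose]

lemma staticForm_isSymm (hQ : Q.IsSymm) : (staticForm A B Q).IsSymm := by
  simp only [Matrix.IsSymm, staticForm, Matrix.transpose_mul, Matrix.transpose_transpose, hQ.eq,
    Matrix.mul_assoc]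

lemma transpose_staticMap_mulVec (y : Fin n ⊕ Fin m → ℝ) (j : Fin m) :
    ((staticMap A B)ᵀ *ᵥ y) j = ∑ i, (-(A⁻¹ * B)) i j * y (Sum.inl i) + y (Sum.inr j) := by
  simp [staticMap, Matrix.mulVec, dotProduct, Matrix.one_apply]

lemma mulVec_neg_inv_mul (hA : IsUnit A.det) (u : Fin m → ℝ) :
    A *ᵥ (-(A⁻¹ * B) *ᵥ u) + B *ᵥ u = 0 := by
  rw [Matrix.neg_mulVec, Matrix.mulVec_neg, Matrix.mulVec_mulVec,
    Matrix.mul_nonsing_inv_cancel_left _ _ hA, neg_add_cancel]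

/-- Transpose of `[A B] S = 0`: pairing with `S` eliminates the multiplier `p`. -/
lemma transpose_staticMap_mulVec_fromRows (hA : IsUnit A.det) (p : Fin n → ℝ) :
    (staticMap A B)ᵀ *ᵥ (Matrix.fromRows Aᵀ Bᵀ *ᵥ p) = 0 := by
  rw [Matrix.mulVec_mulVec, staticMap, Matrix.transpose_fromRows, Matrix.fromCols_mul_fromRows,
    Matrix.transpose_one, Matrix.one_mul, ← Matrix.transpose_mul, ← Matrix.transpose_add, Matrix.mul_neg,
    Matrix.mul_nonsing_inv_cancel_left _ _ hA, neg_add_cancel, Matrix.transpose_zero,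
    Matrix.zero_mulVec]

lemma transpose_staticMap_mulVec_lpVec (hA : IsUnit A.det) (x p : Fin n → ℝ) (u : Fin m → ℝ) :
    (staticMap A B)ᵀ *ᵥ lpVec A B Q x p u = (staticMap A B)ᵀ *ᵥ (Q *ᵥ Sum.elim x u) := by
  rw [lpVec, Matrix.mulVec_add, transpose_staticMap_mulVec_fromRows hA, add_zero]

/-- Bridge between (3) and (4): `d * x` plays the role of `p`, and the remainder has the sign of `Ax
+ Bu` when `d ≥ 0`. -/
lemma lmiForm_mulVec (d x : Fin n → ℝ) (u : Fin m → ℝ) :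
    lmiForm A B Q (Matrix.diagonal d) *ᵥ Sum.elim x u
      = lpVec A B Q x (d * x) u + Sum.elim (d * (A *ᵥ x + B *ᵥ u)) 0 := by
  have hd : ∀ v : Fin n → ℝ, Matrix.diagonal d *ᵥ v = d * v := fun v => by
    ext i; simp [Matrix.mulVec_diagonal]
  rw [lmiForm, lpVec, Matrix.add_mulVec, Matrix.fromBlocks_mulVec, add_assoc,
    Matrix.fromRows_mulVec]
  congr 1
  ext (i | i) <;>
  simp [Matrix.add_mulVec, ← Matrix.mulVec_mulVec, hd, mul_add, add_assoc, Function.comp_def]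

lemma lmiForm_isSymm (hQ : Q.IsSymm) {P : Matrix (Fin n) (Fin n) ℝ} (hP : P.IsDiag) :
    (lmiForm A B Q P).IsSymm := by
  refine hQ.add (Matrix.IsSymm.fromBlocks ?_ ?_ Matrix.isSymm_zero)
  · simp [Matrix.IsSymm, hP.isSymm.eq, add_comm]
  · simp [hP.isSymm.eq]

/-- On the range of `S` one has `Ax + Bu = 0`, so the terms in `P` contribute nothing to the form.
-/
lemma dotProduct_lmiForm_mulVec (hA : IsUnit A.det) {P : Matrix (Fin n) (Fin n) ℝ}
    (hP : P.IsDiag) (u : Fin m → ℝ) :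
    (staticMap A B *ᵥ u) ⬝ᵥ lmiForm A B Q P *ᵥ (staticMap A B *ᵥ u)
      = u ⬝ᵥ staticForm A B Q *ᵥ u := by
  obtain ⟨d, rfl⟩ : ∃ d, P = Matrix.diagonal d := ⟨P.diag, hP.diagonal_diag.symm⟩
  have h : lmiForm A B Q (Matrix.diagonal d) *ᵥ (staticMap A B *ᵥ u)
      = Q *ᵥ (staticMap A B *ᵥ u)
        + Matrix.fromRows Aᵀ Bᵀ *ᵥ (d * (-(A⁻¹ * B) *ᵥ u)) := by
    rw [staticMap_mulVec, lmiForm_mulVec, mulVec_neg_inv_mul hA, mul_zero, Sum.elim_zero_zero,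
      add_zero, lpVec]
  rw [dotProduct_staticForm_mulVec, h, dotProduct_add, add_eq_left, ← Matrix.vecMul_transpose,
    ← Matrix.dotProduct_mulVec, transpose_staticMap_mulVec_fromRows hA, dotProduct_zero]

end Static

end PosKYP

namespace PosKYP

lemma mulVec_apply_nonneg {ι κ : Type*} [Fintype κ] {M : Matrix ι κ ℝ} {v : κ → ℝ} {i : ι}
    (h : ∀ k, 0 ≤ M i k * v k) : 0 ≤ (M *ᵥ v) i :=
  Finset.sum_nonneg fun k _ => h k

/-! ### Positivity and the linear inequalities -/

section Positive

variable {n m : ℕ} {A : Matrix (Fin n) (Fin n) ℝ} {B : Matrix (Fin n) (Fin m) ℝ}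
  {Q : Matrix (Fin n ⊕ Fin m) (Fin n ⊕ Fin m) ℝ}

lemma neg_inv_mul_nonneg (hA : IsMetzler A) (hAH : IsHurwitz A) (hB : ∀ i j, 0 ≤ B i j)
    (i : Fin n) (j : Fin m) : 0 ≤ (-(A⁻¹ * B)) i j := by
  rw [Matrix.neg_apply, neg_nonneg, Matrix.mul_apply]
  exact Finset.sum_nonpos fun k _ =>
    mul_nonpos_of_nonpos_of_nonneg (hA.inv_nonpos hAH i k) (hB k j)

lemma staticMap_nonneg (hA : IsMetzler A) (hAH : IsHurwitz A) (hB : ∀ i j, 0 ≤ B i j)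
    (k : Fin n ⊕ Fin m) (j : Fin m) : 0 ≤ staticMap A B k j := by
  rcases k with i | i
  · exact neg_inv_mul_nonneg hA hAH hB i j
  · simp only [staticMap, Matrix.fromRows_apply_inr, Matrix.one_apply]
    split_ifs <;> norm_num

lemma nonneg_of_ne (hQ : ∀ k l, (¬ ∃ j : Fin m, k = Sum.inr j ∧ l = Sum.inr j) → 0 ≤ Q k l)
    (k l : Fin n ⊕ Fin m) (h : k ≠ l) : 0 ≤ Q k l :=
  hQ k l fun ⟨_, hk, hl⟩ => h (hk.trans hl.symm)

lemma mulVec_sumElim_zero_nonneg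
    (hQ : ∀ k l, (¬ ∃ j : Fin m, k = Sum.inr j ∧ l = Sum.inr j) → 0 ≤ Q k l)
    {x : Fin n → ℝ} (hx : ∀ i, 0 ≤ x i) (k : Fin n ⊕ Fin m) :
    0 ≤ (Q *ᵥ Sum.elim x 0) k := by
  refine mulVec_apply_nonneg fun l => ?_
  rcases l with i | i
  · exact mul_nonneg (hQ _ _ (by simp)) (hx i)
  · simp

lemma mulVec_sumElim_inl_nonneg
    (hQ : ∀ k l, (¬ ∃ j : Fin m, k = Sum.inr j ∧ l = Sum.inr j) → 0 ≤ Q k l)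
    {x : Fin n → ℝ} {u : Fin m → ℝ} (hx : ∀ i, 0 ≤ x i) (hu : ∀ j, 0 ≤ u j) (i : Fin n) :
    0 ≤ (Q *ᵥ Sum.elim x u) (Sum.inl i) := by
  refine mulVec_apply_nonneg fun l => ?_
  rcases l with j | j
  · exact mul_nonneg (hQ _ _ (by simp)) (hx j)
  · exact mul_nonneg (hQ _ _ (by simp)) (hu j)

/-- An unsigned entry of `Q`, at input index `a`, enters with the factor `δₐᵢ δₐⱼ` from the identity
block of `S`, which is zero for `i ≠ j`. -/
lemma staticForm_nonneg_of_ne (hA : IsMetzler A) (hAH : IsHurwitz A) (hB : ∀ i j, 0 ≤ B i j)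
    (hQ : ∀ k l, (¬ ∃ j : Fin m, k = Sum.inr j ∧ l = Sum.inr j) → 0 ≤ Q k l)
    (i j : Fin m) (hij : i ≠ j) : 0 ≤ staticForm A B Q i j := by
  change 0 ≤ ((staticMap A B)ᵀ * Q * staticMap A B) i j
  simp only [Matrix.mul_apply, Matrix.transpose_apply, Finset.sum_mul]
  refine Finset.sum_nonneg fun l _ => Finset.sum_nonneg fun k _ => ?_
  have h1 := staticMap_nonneg hA hAH hB k i
  have h2 := staticMap_nonneg hA hAH hB l j
  by_cases h : ∃ a : Fin m, k = Sum.inr a ∧ l = Sum.inr a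
  · obtain ⟨a, rfl, rfl⟩ := h
    by_cases hai : a = i
    · subst hai
      simp [staticMap, hij]
    · simp [staticMap, hai]
  · exact mul_nonneg (mul_nonneg h1 (hQ k l h)) h2

lemma lmiForm_nonneg_of_ne (hA : IsMetzler A) (hB : ∀ i j, 0 ≤ B i j)
    (hQ : ∀ k l, (¬ ∃ j : Fin m, k = Sum.inr j ∧ l = Sum.inr j) → 0 ≤ Q k l)
    {d : Fin n → ℝ} (hd : ∀ i, 0 ≤ d i) (k l : Fin n ⊕ Fin m) (hkl : k ≠ l) :
    0 ≤ lmiForm A B Q (Matrix.diagonal d) k l := by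
  refine add_nonneg (nonneg_of_ne hQ k l hkl) ?_
  rcases k with i | i <;> rcases l with j | j
  · have hij : i ≠ j := fun h => hkl (h ▸ rfl)
    have h1 := mul_nonneg (hA j i hij.symm) (hd j)
    have h2 := mul_nonneg (hd i) (hA i j hij)
    simpa using add_nonneg h1 h2
  · simpa using mul_nonneg (hd i) (hB i j)
  · simpa using mul_nonneg (hB j i) (hd j)
  · simp

/-- A solution `(x, p, u)` of the linear inequalities dominates the static gain. -/
lemma staticForm_mulVec_le (hA : IsMetzler A) (hAH : IsHurwitz A) (hB : ∀ i j, 0 ≤ B i j)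
    (hQ : ∀ k l, (¬ ∃ j : Fin m, k = Sum.inr j ∧ l = Sum.inr j) → 0 ≤ Q k l)
    {x p : Fin n → ℝ} {u : Fin m → ℝ} (hx : ∀ i, (A *ᵥ x + B *ᵥ u) i ≤ 0)
    (hp : ∀ i, lpVec A B Q x p u (Sum.inl i) ≤ 0) (j : Fin m) :
    (staticForm A B Q *ᵥ u) j ≤ lpVec A B Q x p u (Sum.inr j) := by
  -- `A` sends the excess of `x` over the static response to `Ax + Bu ≤ 0`. This excess only adds a
  -- nonnegative term to `Mu` below.
  have hd : ∀ i, 0 ≤ (x - -(A⁻¹ * B) *ᵥ u) i := hA.nonneg_of_mulVec_nonpos hAH fun i => by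
    have h := mulVec_neg_inv_mul (B := B) hAH.isUnit_det u
    rw [Matrix.mulVec_sub, eq_neg_of_add_eq_zero_left h, sub_neg_eq_add]
    exact hx i
  have hsplit : Sum.elim x u
      = staticMap A B *ᵥ u + Sum.elim (x - -(A⁻¹ * B) *ᵥ u) (0 : Fin m → ℝ) := by
    rw [staticMap_mulVec]
    ext (i | i) <;> simp
  have h1 := congrFun (transpose_staticMap_mulVec_lpVec (Q := Q) (B := B) hAH.isUnit_det x p u) j
  rw [hsplit, Matrix.mulVec_add, Matrix.mulVec_add, ← staticForm_mulVec, Pi.add_apply,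
    transpose_staticMap_mulVec] at h1
  have h2 : 0 ≤ ((staticMap A B)ᵀ *ᵥ (Q *ᵥ Sum.elim (x - -(A⁻¹ * B) *ᵥ u) 0)) j :=
    mulVec_apply_nonneg fun k => mul_nonneg (staticMap_nonneg hA hAH hB k j)
      (mulVec_sumElim_zero_nonneg hQ hd k)
  have h3 : ∑ i, (-(A⁻¹ * B)) i j * lpVec A B Q x p u (Sum.inl i) ≤ 0 :=
    Finset.sum_nonpos fun i _ =>
      mul_nonpos_of_nonneg_of_nonpos (neg_inv_mul_nonneg hA hAH hB i j) (hp i)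
  linarith

/-- Solutions of the linear inequalities with prescribed slack `ε` in the state components. -/
lemma exists_lpVec_eq (hA : IsMetzler A) (hAH : IsHurwitz A) (hB : ∀ i j, 0 ≤ B i j)
    (hQ : ∀ k l, (¬ ∃ j : Fin m, k = Sum.inr j ∧ l = Sum.inr j) → 0 ≤ Q k l)
    {u : Fin m → ℝ} (hu : ∀ j, 0 ≤ u j) :
    ∃ c : Fin m → ℝ, ∀ ε : ℝ, 0 ≤ ε → ∃ x p : Fin n → ℝ, (∀ i, 0 ≤ x i) ∧ (∀ i, 0 ≤ p i) ∧
      (∀ i, (A *ᵥ x + B *ᵥ u) i = -ε) ∧ (∀ i, lpVec A B Q x p u (Sum.inl i) = -ε) ∧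
      ∀ j, lpVec A B Q x p u (Sum.inr j) = (staticForm A B Q *ᵥ u) j + ε * c j := by
  obtain ⟨v, hv, hAv⟩ := hA.exists_pos hAH
  -- Take `x = -A⁻¹Bu + εv` with `Av = -1`, and solve for `p` so that the state rows equal `-ε`.
  -- Pairing with `S` then determines the input rows; `c` is the coefficient of `ε` and does not
  -- depend on `ε`.
  refine ⟨fun j => ((staticMap A B)ᵀ *ᵥ (Q *ᵥ Sum.elim v 0)) j + ∑ i, (-(A⁻¹ * B)) i j,
    fun ε hε => ?_⟩
  have hx : ∀ i, 0 ≤ (-(A⁻¹ * B) *ᵥ u + ε • v) i := fun i =>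
    add_nonneg (mulVec_apply_nonneg fun j =>
      mul_nonneg (neg_inv_mul_nonneg hA hAH hB i j) (hu j)) (mul_nonneg hε (hv i).le)
  set x := -(A⁻¹ * B) *ᵥ u + ε • v with hxdef
  let q : Fin n → ℝ := fun i => (Q *ᵥ Sum.elim x u) (Sum.inl i) + ε
  have hp : Aᵀ *ᵥ (-((A⁻¹)ᵀ *ᵥ q)) = -q := by
    rw [Matrix.mulVec_neg, Matrix.mulVec_mulVec, ← Matrix.transpose_mul,
      Matrix.nonsing_inv_mul _ hAH.isUnit_det, Matrix.transpose_one, Matrix.one_mulVec]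
  have hl : ∀ i, lpVec A B Q x (-((A⁻¹)ᵀ *ᵥ q)) u (Sum.inl i) = -ε := fun i => by
    rw [lpVec, Pi.add_apply, Matrix.fromRows_mulVec, Sum.elim_inl, hp]
    simp [q]
  refine ⟨x, -((A⁻¹)ᵀ *ᵥ q), hx, fun i => ?_, fun i => ?_, hl, fun j => ?_⟩
  · rw [← Matrix.neg_mulVec]
    exact mulVec_apply_nonneg fun k => mul_nonneg (neg_nonneg.2 (hA.inv_nonpos hAH k i))
      (add_nonneg (mulVec_sumElim_inl_nonneg hQ hx hu k) hε)
  · rw [hxdef, Matrix.mulVec_add, Matrix.mulVec_smul, hAv, add_right_comm,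
      mulVec_neg_inv_mul hAH.isUnit_det]
    simp
  · have hsplit : Sum.elim x u = staticMap A B *ᵥ u + ε • Sum.elim v (0 : Fin m → ℝ) := by
      rw [staticMap_mulVec]
      ext (i | i) <;> simp [x]
    have h1 := congrFun (transpose_staticMap_mulVec_lpVec (Q := Q) (B := B) hAH.isUnit_det x
      (-((A⁻¹)ᵀ *ᵥ q)) u) j
    rw [transpose_staticMap_mulVec, hsplit, Matrix.mulVec_add, Matrix.mulVec_add,
      ← staticForm_mulVec, Matrix.mulVec_smul, Matrix.mulVec_smul, Pi.add_apply, Pi.smul_apply,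
      smul_eq_mul, Finset.sum_congr rfl fun i _ => by rw [hl i], ← Finset.sum_mul] at h1
    linarith

end Positive

/-! ### Frequency response versus static gain -/

section Frequency

variable {n m : ℕ} {A : Matrix (Fin n) (Fin n) ℝ} {B : Matrix (Fin n) (Fin m) ℝ}
  {Q : Matrix (Fin n ⊕ Fin m) (Fin n ⊕ Fin m) ℝ}

/-- The transfer matrix of a positive system is dominated by its static gain. -/
lemma norm_transfer_mulVec_le (hA : IsMetzler A) (hAH : IsHurwitz A) (hB : ∀ i j, 0 ≤ B i j)
    (ω : ℝ≥0∞) (v : Fin m → ℂ) (i : Fin n) :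
    ‖(transfer A B ω *ᵥ v) i‖ ≤ (-(A⁻¹ * B) *ᵥ fun j => ‖v j‖) i := by
  by_cases hω : ω = ∞
  · simp only [transfer, hω, if_true, Matrix.zero_mulVec, Pi.zero_apply, norm_zero]
    exact mulVec_apply_nonneg fun j =>
      mul_nonneg (neg_inv_mul_nonneg hA hAH hB i j) (norm_nonneg _)
  set z := transfer A B ω *ᵥ v with hz
  set s : ℂ := Complex.I * (ω.toReal : ℂ) with hs
  have hsre : s.re = 0 := by simp [hs]
  have heq : (s • (1 : Matrix (Fin n) (Fin n) ℂ) - A.map ((↑) : ℝ → ℂ)) *ᵥ z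
      = B.map ((↑) : ℝ → ℂ) *ᵥ v := by
    have hdet := isUnit_iff_ne_zero.2 (hAH.det_ne_zero hsre.ge)
    rw [hz, transfer, if_neg hω, Matrix.mulVec_mulVec, Matrix.mul_nonsing_inv_cancel_left _ _ hdet]
  suffices h : ∀ i, 0 ≤ ((-(A⁻¹ * B) *ᵥ fun j => ‖v j‖) - fun i => ‖z i‖) i by
    simpa using h i
  -- As the static response `y` satisfies `Ay + B|v| = 0`, it remains to show `A|z| + B|v| ≥ 0`.
  -- This is the triangle inequality in row `k` of `(sI - A)z = Bv`, with `|s - aₖₖ| ≥ -aₖₖ` because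
  -- `s` is imaginary.
  refine hA.nonneg_of_mulVec_nonpos hAH fun k => ?_
  have hst := congrFun (mulVec_neg_inv_mul (B := B) hAH.isUnit_det fun j => ‖v j‖) k
  rw [Pi.add_apply, Pi.zero_apply] at hst
  rw [Matrix.mulVec_sub, Pi.sub_apply, eq_neg_of_add_eq_zero_left hst]
  have hk := congrFun heq k
  rw [Matrix.sub_mulVec, Matrix.smul_mulVec, Matrix.one_mulVec, Pi.sub_apply, Pi.smul_apply,
    smul_eq_mul] at hk
  simp only [Matrix.mulVec, dotProduct, Matrix.map_apply] at hk ⊢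
  rw [← Finset.add_sum_erase _ _ (Finset.mem_univ k)] at hk ⊢
  have hk' : (s - A k k) * z k
      = ∑ l ∈ Finset.univ.erase k, (A k l : ℂ) * z l + ∑ j, (B k j : ℂ) * v j := by
    linear_combination hk
  have h1 : -A k k * ‖z k‖ ≤ ‖(s - A k k) * z k‖ := by
    rw [norm_mul]
    refine mul_le_mul_of_nonneg_right ?_ (norm_nonneg _)
    calc -A k k = (s - A k k).re := by simp [hsre]
      _ ≤ _ := Complex.re_le_norm _
  have h2 : ‖(s - A k k) * z k‖
      ≤ ∑ l ∈ Finset.univ.erase k, A k l * ‖z l‖ + ∑ j, B k j * ‖v j‖ := by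
    rw [hk']
    refine (norm_add_le _ _).trans (add_le_add ?_ ?_)
    · refine (norm_sum_le _ _).trans (Finset.sum_le_sum fun l hl => ?_)
      rw [norm_mul, Complex.norm_real, Real.norm_of_nonneg (hA k l (Finset.ne_of_mem_erase hl).symm)]
    · refine (norm_sum_le _ _).trans (Finset.sum_le_sum fun j _ => ?_)
      rw [norm_mul, Complex.norm_real, Real.norm_of_nonneg (hB k j)]
  linarith

lemma freqForm_isHermitian (hQ : Q.IsSymm) (ω : ℝ≥0∞) : (freqForm A B Q ω).IsHermitian := by
  refine Matrix.isHermitian_conjTranspose_mul_mul _ ?_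
  ext i j
  simp [← hQ.apply i j]

/-- Entrywise domination of a Hermitian form by a real quadratic form. -/
lemma re_dotProduct_map_mulVec_le
    (hQ : ∀ k l, (¬ ∃ j : Fin m, k = Sum.inr j ∧ l = Sum.inr j) → 0 ≤ Q k l)
    {y : Fin n ⊕ Fin m → ℂ} {c : Fin n ⊕ Fin m → ℝ} (hy : ∀ k, ‖y k‖ ≤ c k)
    (hy' : ∀ j, ‖y (Sum.inr j)‖ = c (Sum.inr j)) :
    (star y ⬝ᵥ Q.map ((↑) : ℝ → ℂ) *ᵥ y).re ≤ c ⬝ᵥ Q *ᵥ c := by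
  simp only [Matrix.mulVec, dotProduct, Finset.mul_sum, Complex.re_sum, Pi.star_apply,
    Matrix.map_apply]
  refine Finset.sum_le_sum fun k _ => Finset.sum_le_sum fun l _ => ?_
  -- These entries of `Q` may be negative, so a bound on `‖y k‖` is not enough: equality of norms at
  -- input indices is needed.
  by_cases h : ∃ j : Fin m, k = Sum.inr j ∧ l = Sum.inr j
  · obtain ⟨j, rfl, rfl⟩ := h
    rw [← hy']
    refine le_of_eq ?_
    have h1 : star (y (Sum.inr j)) * ((Q (Sum.inr j) (Sum.inr j) : ℂ) * y (Sum.inr j))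
        = ((Q (Sum.inr j) (Sum.inr j) * ‖y (Sum.inr j)‖ ^ 2 : ℝ) : ℂ) := by
      push_cast
      rw [← Complex.conj_mul', Complex.star_def]
      ring
    rw [h1, Complex.ofReal_re]
    ring
  · refine (Complex.re_le_norm _).trans ?_
    rw [norm_mul, norm_mul, norm_star, Complex.norm_real, Real.norm_of_nonneg (hQ k l h)]
    have h0 := hQ k l h
    have hk := (norm_nonneg _).trans (hy k)
    gcongr
    · exact hy k
    · exact hy l

lemma re_dotProduct_freqForm_mulVec_le (hA : IsMetzler A) (hAH : IsHurwitz A)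
    (hB : ∀ i j, 0 ≤ B i j)
    (hQ : ∀ k l, (¬ ∃ j : Fin m, k = Sum.inr j ∧ l = Sum.inr j) → 0 ≤ Q k l)
    (ω : ℝ≥0∞) (v : Fin m → ℂ) :
    (star v ⬝ᵥ freqForm A B Q ω *ᵥ v).re
      ≤ (fun j => ‖v j‖) ⬝ᵥ staticForm A B Q *ᵥ fun j => ‖v j‖ := by
  have h : star v ⬝ᵥ freqForm A B Q ω *ᵥ v
      = star (Matrix.fromRows (transfer A B ω) 1 *ᵥ v) ⬝ᵥ
        Q.map ((↑) : ℝ → ℂ) *ᵥ (Matrix.fromRows (transfer A B ω) 1 *ᵥ v) := by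
    rw [freqForm, ← Matrix.mulVec_mulVec, ← Matrix.mulVec_mulVec, Matrix.dotProduct_mulVec,
      ← Matrix.star_mulVec]
  rw [h, dotProduct_staticForm_mulVec]
  refine re_dotProduct_map_mulVec_le hQ ?_ ?_
  · rintro (i | j)
    · rw [Matrix.fromRows_mulVec, staticMap_mulVec]
      exact norm_transfer_mulVec_le hA hAH hB ω v i
    · simp [Matrix.fromRows_mulVec, staticMap_mulVec]
  · intro j
    simp [Matrix.fromRows_mulVec, staticMap_mulVec]

lemma negSemidef_freqForm_of_staticForm (hA : IsMetzler A) (hAH : IsHurwitz A)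
    (hB : ∀ i j, 0 ≤ B i j) (hQs : Q.IsSymm)
    (hQ : ∀ k l, (¬ ∃ j : Fin m, k = Sum.inr j ∧ l = Sum.inr j) → 0 ≤ Q k l)
    (h : NegSemidef (staticForm A B Q)) (ω : ℝ≥0∞) : NegSemidef (freqForm A B Q ω) := by
  refine Matrix.PosSemidef.of_dotProduct_mulVec_nonneg (freqForm_isHermitian hQs ω).neg fun v => ?_
  rw [Complex.nonneg_iff]
  refine ⟨?_, ((freqForm_isHermitian hQs ω).neg.im_star_dotProduct_mulVec_self v).symm⟩
  have h1 := re_dotProduct_freqForm_mulVec_le hA hAH hB hQ ω v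
  have h2 := (negSemidef_iff (staticForm_isSymm hQs)).1 h fun j => ‖v j‖
  rw [Matrix.neg_mulVec, dotProduct_neg, Complex.neg_re]
  linarith

lemma negDef_freqForm_of_staticForm (hA : IsMetzler A) (hAH : IsHurwitz A)
    (hB : ∀ i j, 0 ≤ B i j) (hQs : Q.IsSymm)
    (hQ : ∀ k l, (¬ ∃ j : Fin m, k = Sum.inr j ∧ l = Sum.inr j) → 0 ≤ Q k l)
    (h : NegDef (staticForm A B Q)) (ω : ℝ≥0∞) : NegDef (freqForm A B Q ω) := by
  refine Matrix.PosDef.of_dotProduct_mulVec_pos (freqForm_isHermitian hQs ω).neg fun v hv => ?_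
  rw [Complex.pos_iff]
  refine ⟨?_, ((freqForm_isHermitian hQs ω).neg.im_star_dotProduct_mulVec_self v).symm⟩
  have h1 := re_dotProduct_freqForm_mulVec_le hA hAH hB hQ ω v
  have h2 := (negDef_iff (staticForm_isSymm hQs)).1 h (fun j => ‖v j‖) fun h0 =>
    hv (funext fun j => norm_eq_zero.1 (congrFun h0 j))
  rw [Matrix.neg_mulVec, dotProduct_neg, Complex.neg_re]
  linarith

lemma transfer_zero (hAH : IsHurwitz A) :
    transfer A B 0 = (-(A⁻¹ * B)).map ((↑) : ℝ → ℂ) := by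
  have h : (-A.map ((↑) : ℝ → ℂ))⁻¹ = (-A⁻¹).map ((↑) : ℝ → ℂ) := by
    refine Matrix.inv_eq_right_inv ?_
    have h1 := congrArg (fun M => M.map ((↑) : ℝ → ℂ)) (Matrix.mul_nonsing_inv A hAH.isUnit_det)
    ext i j
    simpa [Matrix.mul_apply, Matrix.one_apply, apply_ite] using congrFun (congrFun h1 i) j
  simp only [transfer, ENNReal.zero_ne_top, if_false, ENNReal.toReal_zero, Complex.ofReal_zero,
    mul_zero, zero_smul, zero_sub, h]
  ext i j
  simp [Matrix.mul_apply]

lemma freqForm_zero (hAH : IsHurwitz A) :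
    freqForm A B Q 0 = (staticForm A B Q).map ((↑) : ℝ → ℂ) := by
  have h : Matrix.fromRows (transfer A B 0) (1 : Matrix (Fin m) (Fin m) ℂ)
      = (staticMap A B).map ((↑) : ℝ → ℂ) := by
    rw [transfer_zero hAH]
    ext (i | i) j <;> simp [staticMap, Matrix.one_apply, apply_ite]
  change _ = ((staticMap A B)ᵀ * Q * staticMap A B).map ((↑) : ℝ → ℂ)
  rw [freqForm, h]
  ext i j
  simp [Matrix.mul_apply]

lemma dotProduct_freqForm_zero_mulVec (hAH : IsHurwitz A) (v : Fin m → ℝ) :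
    (star fun j => (v j : ℂ)) ⬝ᵥ freqForm A B Q 0 *ᵥ (fun j => (v j : ℂ))
      = ((v ⬝ᵥ staticForm A B Q *ᵥ v : ℝ) : ℂ) := by
  rw [freqForm_zero hAH]
  simp [Matrix.mulVec, dotProduct]

lemma negSemidef_staticForm_of_freqForm (hAH : IsHurwitz A) (hQs : Q.IsSymm)
    (h : NegSemidef (freqForm A B Q 0)) : NegSemidef (staticForm A B Q) := by
  refine (negSemidef_iff (staticForm_isSymm hQs)).2 fun v => ?_
  have h1 := Matrix.PosSemidef.dotProduct_mulVec_nonneg h fun j => (v j : ℂ)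
  rw [Matrix.neg_mulVec, dotProduct_neg, dotProduct_freqForm_zero_mulVec hAH] at h1
  have h2 := (Complex.nonneg_iff.1 h1).1
  simpa using h2

lemma negDef_staticForm_of_freqForm (hAH : IsHurwitz A) (hQs : Q.IsSymm)
    (h : NegDef (freqForm A B Q 0)) : NegDef (staticForm A B Q) := by
  refine (negDef_iff (staticForm_isSymm hQs)).2 fun v hv => ?_
  have h1 := Matrix.PosDef.dotProduct_mulVec_pos h (x := fun j => (v j : ℂ)) fun h0 =>
    hv (funext fun j => Complex.ofReal_eq_zero.1 (congrFun h0 j))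
  rw [Matrix.neg_mulVec, dotProduct_neg, dotProduct_freqForm_zero_mulVec hAH] at h1
  have h2 := (Complex.pos_iff.1 h1).1
  simpa using h2

end Frequency

end PosKYP

/-! ### The two families of equivalences -/

theorem mainTheorem1 {n m : ℕ}
    (A : Matrix (Fin n) (Fin n) ℝ) (B : Matrix (Fin n) (Fin m) ℝ)
    (Q : Matrix (Fin n ⊕ Fin m) (Fin n ⊕ Fin m) ℝ)
    (hA : PosKYP.IsMetzler A) (hAH : PosKYP.IsHurwitz A)
    (hB : ∀ i j, 0 ≤ B i j)
    (hQsymm : Q.IsSymm)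
    (hQ : ∀ k l, (¬ ∃ j : Fin m, k = Sum.inr j ∧ l = Sum.inr j) → 0 ≤ Q k l) :
    (PosKYP.IsStabilizable (-A) B →
      List.TFAE [
        ∀ ω : ℝ≥0∞, PosKYP.NegSemidef (PosKYP.freqForm A B Q ω),
        PosKYP.NegSemidef (PosKYP.staticForm A B Q),
        ∃ P : Matrix (Fin n) (Fin n) ℝ,
          P.IsDiag ∧ P.PosSemidef ∧ PosKYP.NegSemidef (PosKYP.lmiForm A B Q P),
        ∃ (x p : Fin n → ℝ) (u : Fin m → ℝ),
          (∀ i, 0 ≤ x i) ∧ (∀ i, 0 ≤ p i) ∧ (∀ j, 0 < u j) ∧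
          (∀ i, (A *ᵥ x + B *ᵥ u) i ≤ 0) ∧
          (∀ k, PosKYP.lpVec A B Q x p u k ≤ 0)]) ∧
    List.TFAE [
      ∀ ω : ℝ≥0∞, PosKYP.NegDef (PosKYP.freqForm A B Q ω),
      PosKYP.NegDef (PosKYP.staticForm A B Q),
      ∃ P : Matrix (Fin n) (Fin n) ℝ,
        P.IsDiag ∧ P.PosDef ∧ PosKYP.NegDef (PosKYP.lmiForm A B Q P),
      ∃ (x p : Fin n → ℝ) (u : Fin m → ℝ),
        (∀ i, 0 ≤ x i) ∧ (∀ i, 0 ≤ p i) ∧ (∀ j, 0 ≤ u j) ∧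
        (∀ i, (A *ᵥ x + B *ᵥ u) i < 0) ∧
        (∀ k, PosKYP.lpVec A B Q x p u k < 0)] := by
  have hunit := hAH.isUnit_det
  have hMs := PosKYP.staticForm_isSymm (A := A) (B := B) hQsymm
  have hM0 := PosKYP.staticForm_nonneg_of_ne hA hAH hB hQ
  have hmul : ∀ {x p : Fin n → ℝ}, (∀ i, 0 < x i) → (fun i => p i / x i) * x = p :=
    fun hx => funext fun i => div_mul_cancel₀ _ (hx i).ne'
  refine ⟨fun hst => ?_, ?_⟩
  · tfae_have 1 → 2 := fun h => PosKYP.negSemidef_staticForm_of_freqForm hAH hQsymm (h 0)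
    tfae_have 2 → 1 := PosKYP.negSemidef_freqForm_of_staticForm hA hAH hB hQsymm hQ
    tfae_have 3 → 2 := by
      rintro ⟨P, hP, -, hL⟩
      refine (PosKYP.negSemidef_iff hMs).2 fun v => ?_
      rw [← PosKYP.dotProduct_lmiForm_mulVec hunit hP]
      exact (PosKYP.negSemidef_iff (PosKYP.lmiForm_isSymm hQsymm hP)).1 hL _
    tfae_have 2 → 4 := by
      intro h
      obtain ⟨u, hu, hMu⟩ := PosKYP.exists_pos_mulVec_nonpos_of_negSemidef hMs hM0 h
      obtain ⟨c, hc⟩ := PosKYP.exists_lpVec_eq hA hAH hB hQ fun j => (hu j).le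
      -- With zero slack the state rows vanish and the input rows are exactly `Mu ≤ 0`.
      obtain ⟨x, p, hx, hp, h1, h2, h3⟩ := hc 0 le_rfl
      refine ⟨x, p, u, hx, hp, hu, fun i => by simp [h1], ?_⟩
      rintro (i | j)
      · simp [h2]
      · simpa [h3] using hMu j
    tfae_have 4 → 3 := by
      rintro ⟨x, p, u, hx, hp, hu, h1, h2⟩
      have hx' := hst.pos_of_mulVec_nonpos hA hAH hB hx hu h1
      have hd : ∀ i, 0 ≤ p i / x i := fun i => div_nonneg (hp i) (hx i)
      refine ⟨Matrix.diagonal fun i => p i / x i, Matrix.isDiag_diagonal _,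
        Matrix.posSemidef_diagonal_iff.2 hd, PosKYP.negSemidef_of_mulVec_nonpos
          (u := Sum.elim x u) (PosKYP.lmiForm_isSymm hQsymm (Matrix.isDiag_diagonal _))
          (PosKYP.lmiForm_nonneg_of_ne hA hB hQ hd) ?_ ?_⟩
      · rintro (i | j)
        exacts [hx' i, hu j]
      · intro k
        rw [PosKYP.lmiForm_mulVec, hmul hx', Pi.add_apply]
        refine add_nonpos (h2 k) ?_
        rcases k with i | j
        · exact mul_nonpos_of_nonneg_of_nonpos (hd i) (h1 i)
        · exact le_rfl
    tfae_finish
  · tfae_have 1 → 2 := fun h => PosKYP.negDef_staticForm_of_freqForm hAH hQsymm (h 0)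
    tfae_have 2 → 1 := PosKYP.negDef_freqForm_of_staticForm hA hAH hB hQsymm hQ
    tfae_have 3 → 2 := by
      rintro ⟨P, hP, -, hL⟩
      refine (PosKYP.negDef_iff hMs).2 fun v hv => ?_
      rw [← PosKYP.dotProduct_lmiForm_mulVec hunit hP]
      refine (PosKYP.negDef_iff (PosKYP.lmiForm_isSymm hQsymm hP)).1 hL _ fun h0 => hv ?_
      rw [PosKYP.staticMap_mulVec] at h0
      exact funext fun j => congrFun h0 (Sum.inr j)
    tfae_have 2 → 4 := by
      intro h
      obtain ⟨u, hu, hMu⟩ := PosKYP.exists_pos_mulVec_eq_neg_one_of_negDef hMs hM0 h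
      obtain ⟨c, hc⟩ := PosKYP.exists_lpVec_eq hA hAH hB hQ fun j => (hu j).le
      have hC : 0 ≤ ∑ j, |c j| := Finset.sum_nonneg fun _ _ => abs_nonneg _
      obtain ⟨ε, hε, hεc⟩ : ∃ ε : ℝ, 0 < ε ∧ ∀ j, ε * c j < 1 := by
        -- Small enough that the perturbation `ε * c j` stays below the margin 1 in `Mu = -1`.
        refine ⟨(1 + ∑ j, |c j|)⁻¹, by positivity, fun j => ?_⟩
        rw [inv_mul_lt_iff₀ (by positivity), mul_one]
        have := Finset.single_le_sum (f := fun j => |c j|) (fun _ _ => abs_nonneg _)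
          (Finset.mem_univ j)
        have := le_abs_self (c j)
        linarith
      obtain ⟨x, p, hx, hp, h1, h2, h3⟩ := hc ε hε.le
      refine ⟨x, p, u, hx, hp, fun j => (hu j).le, fun i => by rw [h1]; linarith, ?_⟩
      rintro (i | j)
      · rw [h2]; linarith
      · rw [h3, hMu]; linarith [hεc j]
    tfae_have 4 → 3 := by
      rintro ⟨x, p, u, hx, hp, hu, h1, h2⟩
      -- Strictness forces positivity: a zero entry of `x`, `p` or `u` would make the matching entry
      -- of `Ax + Bu`, of the state rows, or of `Mu` nonnegative, by the Metzler property of `A`,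
      -- `Aᵀ` or `M`.
      have hx' : ∀ i, 0 < x i := fun i => (hx i).lt_of_ne fun hi => by
        have h3 := PosKYP.mulVec_nonneg_of_apply_eq_zero hA hx hi.symm
        have h4 : 0 ≤ ∑ j, B i j * u j := Finset.sum_nonneg fun j _ => mul_nonneg (hB i j) (hu j)
        exact absurd (h1 i) (not_lt.2 (add_nonneg h3 h4))
      have hp' : ∀ i, 0 < p i := fun i => (hp i).lt_of_ne fun hi => by
        have h3 := PosKYP.mulVec_nonneg_of_apply_eq_zero (A := Aᵀ)
          (fun k l hkl => hA l k hkl.symm) hp hi.symm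
        have h4 := PosKYP.mulVec_sumElim_inl_nonneg hQ hx hu i
        have h5 := h2 (Sum.inl i)
        rw [PosKYP.lpVec, Pi.add_apply, Matrix.fromRows_mulVec, Sum.elim_inl] at h5
        linarith
      have hu' : ∀ j, 0 < u j := fun j => (hu j).lt_of_ne fun hj => by
        have h3 := PosKYP.mulVec_nonneg_of_apply_eq_zero hM0 hu hj.symm
        have h4 := PosKYP.staticForm_mulVec_le hA hAH hB hQ (fun i => (h1 i).le)
          (fun i => (h2 (Sum.inl i)).le) j
        exact absurd (h2 (Sum.inr j)) (not_lt.2 (h3.trans h4))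
      have hd : ∀ i, 0 < p i / x i := fun i => div_pos (hp' i) (hx' i)
      refine ⟨Matrix.diagonal fun i => p i / x i, Matrix.isDiag_diagonal _,
        Matrix.posDef_diagonal_iff.2 hd, PosKYP.negDef_of_mulVec_neg
          (u := Sum.elim x u) (PosKYP.lmiForm_isSymm hQsymm (Matrix.isDiag_diagonal _))
          (PosKYP.lmiForm_nonneg_of_ne hA hB hQ fun i => (hd i).le) ?_ ?_⟩
      · rintro (i | j)
        exacts [hx' i, hu' j]
      · intro k
        rw [PosKYP.lmiForm_mulVec, hmul hx', Pi.add_apply]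
        refine add_neg_of_neg_of_nonpos (h2 k) ?_
        rcases k with i | j
        · exact (mul_neg_of_pos_of_neg (hd i) (h1 i)).le
        · exact le_rfl
    tfae_finish
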